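/- Consider a base station with $M$ antennas and a grid of beams $\bm g_1,\dots,\bm g_N\in\mathbb C^M$ with $\|\bm g_k\|^2=M\beta$, $\beta>0$, for every $k$. The single-antenna terminal knows the downlink beam $\bm g$ but not the phase shift $\theta\in\mathbb R$, and it selects its uplink sequence of length $\tau$ as a function of the beam: $\bm\phi_k=s(\bm g_k)\in\mathbb C^\tau$ with $\|\bm\phi_k\|=1$. Reciprocity holds: if the true beam is $\bm g_n$, the base station receives $\bm Y=\sqrt{\rho}\,e^{i\theta}\bm g_n\bm\phi_n^{T}+\bm W\in\mathbb C^{M\times\tau}$, where $\rho>0$ and $\bm W$ has independent $\mathcal{CN}(0,1)$ entries. The base station knows the map $s$ and uses the concentrated-likelihood detector, which maximizes $|\bm\phi_k^{T}\bm Y^{H}\bm g_k|$ over $k$. The pairwise error probability of $n'$ against $n$ is $$P_{n\to n'}=\Pr\left(|\bm\phi_{n'}^{T}\bm Y^{H}\bm g_{n'}|>|\bm\phi_{n}^{T}\bm Y^{H}\bm g_{n}|\right),$$ where $\bm g_n$ is the true beam. Put $c=|\bm\phi_n^{H}\bm\phi_{n'}\,\bm g_n^{H}\bm g_{n'}|$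 and assume $c<M\beta$, i.e. $\bm g_{n'}\bm\phi_{n'}^{T}$ is not a phase rotation of $\bm g_n\bm\phi_n^{T}$. Compare two such systems, each with its own $M,\tau,N,\beta,\rho,\theta$, beams, map $s$ and pair $(n,n')$. Then: 1. If $\rho$ and $M\beta$ are the same in both, the system with the strictly smaller $c$ has the strictly smaller $P_{n\to n'}$. 2. If $c$ is the same in both, and one system has $\rho$ and $M\beta$ at least as large as the other and a strictly larger $\sqrt{\rho M\beta}$, then it has the strictly smaller $P_{n\to n'}$. 3. More generally, if one system has $c/(M\beta)$ at most as large and $\sqrt{\rho M\beta}$ at least as large as the other, then its $P_{n\to n'}$ is at most as large, and strictly smaller if one of these two inequalities is strict. In particular $P_{n\to n'}$ depends only on $c/(M\beta)$ and $\sqrt{\rho M\beta}$; it strictly decreases when $c/(M\beta)$ decreases and when $\sqrt{\rho M\beta}$ increases. -/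

import Mathlib

open scoped Matrix

namespace PartialCSI

/-- The standard circularly symmetric complex Gaussian law `CN(0,1)`: the real and the imaginary
part are independent, centred and real Gaussian of variance `1/2`. -/
noncomputable def complexGaussian : MeasureTheory.Measure ℂ :=
  ((ProbabilityTheory.gaussianReal 0 (1 / 2)).prod
    (ProbabilityTheory.gaussianReal 0 (1 / 2))).map Complex.measurableEquivRealProd.symm

instance : MeasureTheory.IsProbabilityMeasure complexGaussian :=
  MeasureTheory.Measure.isProbabilityMeasure_map
    Complex.measurableEquivRealProd.symm.measurable.aemeasurable

/-- The law of an `M × τ` noise matrix with independent `CN(0,1)` entries. -/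
noncomputable def noiseLaw (M τ : ℕ) : MeasureTheory.Measure (Fin M → Fin τ → ℂ) :=
  MeasureTheory.Measure.pi fun _ => MeasureTheory.Measure.pi fun _ => complexGaussian

/-- The reciprocal uplink with a grid of `N` beams in `ℂ^M`, all of squared norm `M β`. The
terminal knows its beam `g` and transmits the unit-norm sequence `seqMap g` of length `τ`; the
phase shift `θ` is an unknown parameter, and `ρ` is the SNR. -/
structure System (M τ N : ℕ) where
  /-- the grid of beams `g_1, …, g_N` -/
  beam : Fin N → Fin M → ℂ
  /-- the map from downlink channels to uplink sequences -/
  seqMap : (Fin M → ℂ) → (Fin τ → ℂ)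
  β : ℝ
  ρ : ℝ
  θ : ℝ
  β_pos : 0 < β
  ρ_pos : 0 < ρ
  norm_beam : ∀ n, ∑ i, ‖beam n i‖ ^ 2 = M * β
  norm_seq : ∀ n, ∑ j, ‖seqMap (beam n) j‖ ^ 2 = 1

namespace System

variable {M τ N : ℕ}

/-- The sequence `φ_n` that is transmitted when the beam is `g_n`. -/
def seq (S : System M τ N) (n : Fin N) : Fin τ → ℂ := S.seqMap (S.beam n)

/-- The received signal `Y = √ρ e^{iθ} g_n φ_nᵀ + W` when the true beam is `g_n`. -/
noncomputable def received (S : System M τ N) (n : Fin N) (W : Fin M → Fin τ → ℂ) :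
    Matrix (Fin M) (Fin τ) ℂ :=
  ((Real.sqrt S.ρ : ℂ) * Complex.exp (Complex.I * S.θ)) • Matrix.vecMulVec (S.beam n) (S.seq n)
    + Matrix.of W

/-- The statistic `|φ_kᵀ Yᴴ g_k|` that the detector maximises over `k`. -/
noncomputable def statistic (S : System M τ N) (Y : Matrix (Fin M) (Fin τ) ℂ) (k : Fin N) : ℝ :=
  ‖S.seq k ⬝ᵥ (Yᴴ *ᵥ S.beam k)‖

/-- The pairwise error probability: the probability that the detector prefers beam `n'` to
beam `n` when the true beam is `n`. -/
noncomputable def pep (S : System M τ N) (n n' : Fin N) : ℝ :=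
  (noiseLaw M τ).real
    {W | S.statistic (S.received n W) n < S.statistic (S.received n W) n'}

/-- The metric `|φ_nᴴ φ_{n'} g_nᴴ g_{n'}|`. -/
noncomputable def corr (S : System M τ N) (n n' : Fin N) : ℝ :=
  ‖(star (S.seq n) ⬝ᵥ S.seq n') * (star (S.beam n) ⬝ᵥ S.beam n')‖

end System

end PartialCSI

open MeasureTheory ProbabilityTheory
open scoped ComplexConjugate

namespace PartialCSI

/-! Normalise the two rank-one signals to unit vectors `u`, `v` with real correlation `r = c / (M
β)`, and put `q = √(1 - r²)`, `s = √(ρ M β)`. The noise enters only through its projections on an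
orthonormal pair, which are independent `CN(0,1)` variables `Z₁`, `Z₂` (`map_noiseLaw_orthonormal`).
The error event becomes `|z| < |r z + q Z₂|` with `z = s + Z₁`.

Given `z`, the variable `Z₂` must avoid a disc around the origin. In direction `θ` the boundary of
the disc is at distance `κ |z|`, where `κ² + 2 m κ = 1` and `m = (r / q) cos θ`, so the radial
integral is `exp (-κ² |z|²)`. Averaging over `Z₁` gives `w exp (-S (1 - w))` with `w = 1 / (1 + κ²)`
and `S = s²`. Hence the error probability is the average of this over `θ`, which is `errorProb r S`.

The integrand is not monotone in `r` for each `θ`: `w` grows where `cos θ > 0` and shrinks where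
`cos θ < 0`. But `w = 1/2 + x` with `x` odd in `m`, so adding the terms of `θ` and `θ + π` leaves
`exp (-S/2) (cosh (S x) + 2 x sinh (S x))`. This increases with `|x|`, hence with `r`, and decreases
in `S` because `|x| < 1/2`. Thus `errorProb_lt_errorProb` holds pointwise under the integral. -/

/-! ### Characteristic functions and projections of the noise -/

theorem integral_exp_re_mul_complexGaussian (a : ℂ) :
    ∫ z, Complex.exp (((conj a * z).re : ℝ) * Complex.I) ∂complexGaussian
      = Complex.exp ((-(‖a‖ ^ 2 / 4) : ℝ)) := by
  have key : ∀ t : ℝ, ∫ x, Complex.exp (t * x * Complex.I) ∂(gaussianReal 0 (1 / 2))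
      = Complex.exp ((-(t ^ 2 / 4) : ℝ)) := by
    intro t
    rw [← charFun_apply_real, charFun_gaussianReal]
    congr 1
    push_cast
    ring
  rw [complexGaussian, integral_map_equiv]
  have h : ∀ p : ℝ × ℝ, Complex.exp (((conj a * Complex.measurableEquivRealProd.symm p).re : ℝ)
      * Complex.I) = Complex.exp (a.re * p.1 * Complex.I) * Complex.exp (a.im * p.2 * Complex.I) := by
    intro p
    rw [← Complex.exp_add]
    congr 1
    simp [Complex.mul_re, Complex.measurableEquivRealProd_symm_apply]
    ring
  simp_rw [h]
  rw [integral_prod_mul (fun x : ℝ => Complex.exp (a.re * x * Complex.I))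
    (fun x : ℝ => Complex.exp (a.im * x * Complex.I)), key, key, ← Complex.exp_add,
    ← Complex.normSq_eq_norm_sq, Complex.normSq_apply]
  congr 1
  push_cast
  ring

theorem integral_exp_re_sum_noiseLaw {M τ : ℕ} (c : Fin M → Fin τ → ℂ) :
    ∫ W, Complex.exp (((∑ i, ∑ j, conj (c i j) * W i j).re : ℝ) * Complex.I) ∂(noiseLaw M τ)
      = Complex.exp ((-((∑ i, ∑ j, ‖c i j‖ ^ 2) / 4) : ℝ)) := by
  have h : ∀ W : Fin M → Fin τ → ℂ,
      Complex.exp (((∑ i, ∑ j, conj (c i j) * W i j).re : ℝ) * Complex.I)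
        = ∏ i, ∏ j, Complex.exp (((conj (c i j) * W i j).re : ℝ) * Complex.I) := by
    intro W
    simp_rw [← Complex.exp_sum, ← Finset.sum_mul, ← Complex.ofReal_sum, ← Complex.re_sum]
  simp_rw [h]
  rw [noiseLaw, integral_fintype_prod_eq_prod (𝕜 := ℂ)
    (f := fun i (w : Fin τ → ℂ) => ∏ j, Complex.exp (((conj (c i j) * w j).re : ℝ) * Complex.I))]
  have h2 : ∀ i, ∫ w : Fin τ → ℂ, ∏ j, Complex.exp (((conj (c i j) * w j).re : ℝ) * Complex.I)
      ∂(Measure.pi fun _ => complexGaussian)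
      = ∏ j, Complex.exp ((-(‖c i j‖ ^ 2 / 4) : ℝ)) := by
    intro i
    rw [integral_fintype_prod_eq_prod (𝕜 := ℂ)
      (f := fun j (z : ℂ) => Complex.exp (((conj (c i j) * z).re : ℝ) * Complex.I))]
    simp_rw [integral_exp_re_mul_complexGaussian]
  simp_rw [h2, ← Complex.exp_sum]
  congr 1
  push_cast
  simp_rw [Finset.sum_neg_distrib, Finset.sum_div]

instance (M τ : ℕ) : IsProbabilityMeasure (noiseLaw M τ) := by
  unfold noiseLaw; infer_instance

theorem exists_dual_eq_re_conj_mul (L : StrongDual ℝ ℂ) : ∃ a : ℂ, ∀ z, L z = (conj a * z).re := by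
  refine ⟨(InnerProductSpace.toDual ℝ ℂ).symm L, fun z => ?_⟩
  rw [← InnerProductSpace.toDual_symm_apply (𝕜 := ℝ) (x := z) (y := L), Complex.inner, mul_comm]

theorem charFunDual_complexGaussian {L : StrongDual ℝ ℂ} {a : ℂ}
    (h : ∀ z, L z = (conj a * z).re) :
    charFunDual complexGaussian L = Complex.exp ((-(‖a‖ ^ 2 / 4) : ℝ)) := by
  rw [charFunDual_apply, ← integral_exp_re_mul_complexGaussian]
  simp_rw [h]

/-- The law `CN(0,1)` is invariant under rotations. -/
theorem map_mul_complexGaussian {c : ℂ} (hc : ‖c‖ = 1) :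
    complexGaussian.map (fun z => c * z) = complexGaussian := by
  have hm : Measurable fun z : ℂ => c * z := by fun_prop
  have := Measure.isProbabilityMeasure_map (μ := complexGaussian) hm.aemeasurable
  refine Measure.ext_of_charFunDual (funext fun L => ?_)
  obtain ⟨a, ha⟩ := exists_dual_eq_re_conj_mul L
  rw [charFunDual_complexGaussian ha, charFunDual_apply, integral_map hm.aemeasurable (by fun_prop)]
  have h : ∀ z, L (c * z) = (conj (a * conj c) * z).re := by
    intro z
    rw [ha]
    simp [mul_assoc]
  simp_rw [h]
  rw [integral_exp_re_mul_complexGaussian]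
  simp [hc]

/-- Two functionals of the noise that belong to orthonormal vectors are independent and
`CN(0,1)`. -/
theorem map_noiseLaw_orthonormal {M τ : ℕ} {u w : Fin M → Fin τ → ℂ}
    (hu : ∑ i, ∑ j, ‖u i j‖ ^ 2 = 1) (hw : ∑ i, ∑ j, ‖w i j‖ ^ 2 = 1)
    (huw : ∑ i, ∑ j, conj (w i j) * u i j = 0) :
    (noiseLaw M τ).map (fun W => (∑ i, ∑ j, conj (u i j) * W i j, ∑ i, ∑ j, conj (w i j) * W i j))
      = complexGaussian.prod complexGaussian := by
  have hm : Measurable fun W : Fin M → Fin τ → ℂ =>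
      (∑ i, ∑ j, conj (u i j) * W i j, ∑ i, ∑ j, conj (w i j) * W i j) := by fun_prop
  have := Measure.isProbabilityMeasure_map (μ := noiseLaw M τ) hm.aemeasurable
  refine Measure.ext_of_charFunDual (funext fun L => ?_)
  obtain ⟨a, ha⟩ := exists_dual_eq_re_conj_mul (L.comp (.inl ℝ ℂ ℂ))
  obtain ⟨b, hb⟩ := exists_dual_eq_re_conj_mul (L.comp (.inr ℝ ℂ ℂ))
  rw [charFunDual_prod, charFunDual_complexGaussian ha, charFunDual_complexGaussian hb,
    charFunDual_apply, integral_map hm.aemeasurable (by fun_prop)]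
  have hL : ∀ p : ℂ × ℂ, L p = (conj a * p.1).re + (conj b * p.2).re := by
    intro p
    rw [← ha, ← hb, L.comp_inl_add_comp_inr]
  have h : ∀ W : Fin M → Fin τ → ℂ,
      (conj a * ∑ i, ∑ j, conj (u i j) * W i j).re + (conj b * ∑ i, ∑ j, conj (w i j) * W i j).re
        = (∑ i, ∑ j, conj (a * u i j + b * w i j) * W i j).re := by
    intro W
    rw [← Complex.add_re]
    congr 1
    simp_rw [Finset.mul_sum, ← Finset.sum_add_distrib]
    refine Finset.sum_congr rfl fun i _ => Finset.sum_congr rfl fun j _ => ?_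
    rw [map_add, map_mul, map_mul]
    ring
  simp_rw [hL, h]
  rw [integral_exp_re_sum_noiseLaw, ← Complex.exp_add, ← Complex.ofReal_add]
  congr 2
  -- Summed over `i` and `j`, the cross term vanishes by `huw`, so the exponent splits into `‖a‖ ^ 2
  -- + ‖b‖ ^ 2`.
  have h3 : ∀ i j, ‖a * u i j + b * w i j‖ ^ 2 = ‖a‖ ^ 2 * ‖u i j‖ ^ 2 + ‖b‖ ^ 2 * ‖w i j‖ ^ 2
      + 2 * (a * conj b * (conj (w i j) * u i j)).re := by
    intro i j
    rw [← Complex.normSq_eq_norm_sq, Complex.normSq_add, map_mul, map_mul]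
    simp only [Complex.normSq_eq_norm_sq]
    congr 3
    rw [map_mul]
    ring
  simp_rw [h3, Finset.sum_add_distrib, ← Finset.mul_sum, ← Complex.re_sum, ← Finset.mul_sum]
  rw [hu, hw, huw]
  simp
  ring

/-! ### Gaussian integrals -/

theorem lintegral_complexGaussian {f : ℂ → ENNReal} (hf : Measurable f) :
    ∫⁻ z, f z ∂complexGaussian
      = ∫⁻ z, ENNReal.ofReal (Real.pi⁻¹ * Real.exp (-‖z‖ ^ 2)) * f z := by
  have hpdf : Measurable (gaussianPDF 0 (1 / 2)) := measurable_gaussianPDF _ _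
  rw [complexGaussian, lintegral_map_equiv, gaussianReal_of_var_ne_zero _ (by norm_num),
    prod_withDensity hpdf hpdf, lintegral_withDensity_eq_lintegral_mul _ (by fun_prop)
      (show Measurable fun p => f (Complex.measurableEquivRealProd.symm p) from
        hf.comp Complex.measurableEquivRealProd.symm.measurable),
    ← Complex.volume_preserving_equiv_real_prod.symm.lintegral_comp (by fun_prop),
    Measure.volume_eq_prod]
  refine lintegral_congr fun p => ?_
  simp only [Pi.mul_apply]
  congr 1
  rw [gaussianPDF, gaussianPDF, ← ENNReal.ofReal_mul (gaussianPDFReal_nonneg _ _ _),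
    gaussianPDFReal, gaussianPDFReal, ← Complex.normSq_eq_norm_sq, Complex.normSq_apply]
  congr 1
  have hv : (2 : ℝ) * Real.pi * ((1 / 2 : NNReal) : ℝ) = Real.pi := by push_cast; ring
  rw [hv, mul_mul_mul_comm, ← mul_inv, Real.mul_self_sqrt Real.pi_pos.le, ← Real.exp_add]
  congr 2
  simp [Complex.measurableEquivRealProd_symm_apply]
  ring

/-- Completing the square turns the integrand times the density into a constant times the density of
mean `-(k s / (1 + k))` and variance `1 / (2 (1 + k))`, which has mass one. -/
theorem lintegral_exp_neg_mul_sq_gaussianReal {k : ℝ} (hk : 0 ≤ k) (s : ℝ) :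
    ∫⁻ x, ENNReal.ofReal (Real.exp (-(k * (s + x) ^ 2))) ∂(gaussianReal 0 (1 / 2))
      = ENNReal.ofReal ((√(1 + k))⁻¹ * Real.exp (-(s ^ 2 * (k / (1 + k))))) := by
  have hk1 : 0 < 1 + k := by linarith
  obtain ⟨v, hv⟩ : ∃ v : NNReal, (v : ℝ) = 1 / (2 * (1 + k)) :=
    ⟨⟨1 / (2 * (1 + k)), by positivity⟩, rfl⟩
  have hv0 : v ≠ 0 := by
    rw [← NNReal.coe_ne_zero, hv]
    positivity
  have hC : 0 ≤ (√(1 + k))⁻¹ * Real.exp (-(s ^ 2 * (k / (1 + k)))) := by positivity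
  rw [gaussianReal_of_var_ne_zero _ (by norm_num),
    lintegral_withDensity_eq_lintegral_mul _ (measurable_gaussianPDF _ _) (by fun_prop)]
  have h : ∀ x : ℝ, (gaussianPDF 0 (1 / 2) * fun x =>
      ENNReal.ofReal (Real.exp (-(k * (s + x) ^ 2)))) x
      = ENNReal.ofReal ((√(1 + k))⁻¹ * Real.exp (-(s ^ 2 * (k / (1 + k)))))
        * ENNReal.ofReal (gaussianPDFReal (-(k * s / (1 + k))) v x) := by
    intro x
    rw [Pi.mul_apply, gaussianPDF, ← ENNReal.ofReal_mul (gaussianPDFReal_nonneg _ _ _),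
      ← ENNReal.ofReal_mul hC, gaussianPDFReal, gaussianPDFReal]
    congr 1
    have h1 : (2 : ℝ) * Real.pi * ((1 / 2 : NNReal) : ℝ) = Real.pi := by push_cast; ring
    have h2 : (2 : ℝ) * Real.pi * (v : ℝ) = Real.pi / (1 + k) := by
      rw [hv]; field_simp
    have h3 : (2 : ℝ) * ((1 / 2 : NNReal) : ℝ) = 1 := by push_cast; ring
    have h4 : (2 : ℝ) * (v : ℝ) = 1 / (1 + k) := by
      rw [hv]; field_simp
    rw [h1, h2, h3, h4, Real.sqrt_div Real.pi_pos.le, mul_assoc, ← Real.exp_add,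
      mul_mul_mul_comm, ← Real.exp_add]
    have h5 : √(1 + k) ≠ 0 := by positivity
    have h6 : √Real.pi ≠ 0 := by positivity
    congr 1
    · field_simp
    · congr 1
      field_simp
      ring
  rw [lintegral_congr h, lintegral_const_mul _ (by fun_prop),
    lintegral_gaussianPDFReal_eq_one _ hv0, mul_one]

theorem lintegral_exp_neg_mul_norm_sq_complexGaussian {k : ℝ} (hk : 0 ≤ k) (s : ℝ) :
    ∫⁻ z : ℂ, ENNReal.ofReal (Real.exp (-(k * ‖s + z‖ ^ 2))) ∂complexGaussian
      = ENNReal.ofReal ((1 + k)⁻¹ * Real.exp (-(s ^ 2 * (k / (1 + k))))) := by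
  rw [complexGaussian, lintegral_map_equiv]
  have h : ∀ p : ℝ × ℝ, ENNReal.ofReal
      (Real.exp (-(k * ‖s + Complex.measurableEquivRealProd.symm p‖ ^ 2)))
      = ENNReal.ofReal (Real.exp (-(k * (s + p.1) ^ 2)))
        * ENNReal.ofReal (Real.exp (-(k * (0 + p.2) ^ 2))) := by
    intro p
    rw [← ENNReal.ofReal_mul (Real.exp_nonneg _), ← Real.exp_add, ← Complex.normSq_eq_norm_sq,
      Complex.normSq_apply]
    congr 2
    simp [Complex.measurableEquivRealProd_symm_apply]
    ring
  simp_rw [h]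
  rw [lintegral_prod_mul (f := fun x : ℝ => ENNReal.ofReal (Real.exp (-(k * (s + x) ^ 2))))
      (g := fun x : ℝ => ENNReal.ofReal (Real.exp (-(k * (0 + x) ^ 2))))
      (by fun_prop) (by fun_prop), lintegral_exp_neg_mul_sq_gaussianReal hk,
    lintegral_exp_neg_mul_sq_gaussianReal hk, ← ENNReal.ofReal_mul (by positivity)]
  congr 1
  rw [mul_mul_mul_comm, ← mul_inv, Real.mul_self_sqrt (by linarith), ← Real.exp_add]
  simp

theorem lintegral_Ioi_mul_exp_neg_sq {d : ℝ} (hd : 0 ≤ d) :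
    ∫⁻ ρ in Set.Ioi d, ENNReal.ofReal (ρ * Real.exp (-ρ ^ 2))
      = ENNReal.ofReal (Real.exp (-d ^ 2) / 2) := by
  have hderiv : ∀ x ∈ Set.Ici d,
      HasDerivAt (fun x : ℝ => -(Real.exp (-x ^ 2) / 2)) (x * Real.exp (-x ^ 2)) x := by
    intro x _
    exact (((hasDerivAt_pow 2 x).fun_neg.exp).div_const 2).fun_neg.congr_deriv (by push_cast; ring)
  have hlim : Filter.Tendsto (fun x : ℝ => -(Real.exp (-x ^ 2) / 2)) Filter.atTop (nhds 0) := by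
    have h1 : Filter.Tendsto (fun x : ℝ => Real.exp (-x ^ 2)) Filter.atTop (nhds 0) :=
      Real.tendsto_exp_neg_atTop_nhds_zero.comp (Filter.tendsto_pow_atTop (two_ne_zero))
    simpa using (h1.div_const 2).neg
  have hpos : ∀ x ∈ Set.Ioi d, 0 ≤ x * Real.exp (-x ^ 2) := fun x hx =>
    mul_nonneg (hd.trans (le_of_lt hx)) (Real.exp_nonneg _)
  rw [← ofReal_integral_eq_lintegral_ofReal
      (integrableOn_Ioi_deriv_of_nonneg' hderiv hpos hlim)
      ((ae_restrict_iff' measurableSet_Ioi).2 (Filter.Eventually.of_forall hpos)),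
    integral_Ioi_of_hasDerivAt_of_nonneg' hderiv hpos hlim]
  simp

/-! ### Exterior of a disc in polar coordinates -/

/-- The positive root of `κ² + 2 m κ - 1`. -/
noncomputable def positiveRoot (m : ℝ) : ℝ := √(1 + m ^ 2) - m

theorem positiveRoot_pos (m : ℝ) : 0 < positiveRoot m :=
  sub_pos.2 (Real.lt_sqrt_of_sq_lt (by linarith))

theorem positiveRoot_sq (m : ℝ) : positiveRoot m ^ 2 + 2 * m * positiveRoot m = 1 := by
  have := Real.sq_sqrt (show 0 ≤ 1 + m ^ 2 by positivity)
  rw [positiveRoot]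
  linear_combination this

@[fun_prop]
theorem continuous_positiveRoot : Continuous positiveRoot := by
  unfold positiveRoot; fun_prop

@[fun_prop]
theorem measurable_positiveRoot : Measurable positiveRoot :=
  continuous_positiveRoot.measurable

/-- The quadratic in `ρ` has the roots `x κ` and `-x (κ + 2 m)`. Since `κ (κ + 2 m) = 1`, the second
root is never positive and only the first matters for `ρ > 0`. -/
theorem mul_positiveRoot_lt_iff {m x ρ : ℝ} (hx : 0 ≤ x) (hρ : 0 < ρ) :
    x * positiveRoot m < ρ ↔ 0 < ρ ^ 2 + 2 * m * x * ρ - x ^ 2 := by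
  have hκ := positiveRoot_pos m
  have hκ2 := positiveRoot_sq m
  have hfac : ρ ^ 2 + 2 * m * x * ρ - x ^ 2
      = (ρ - x * positiveRoot m) * (ρ + x * (positiveRoot m + 2 * m)) := by
    linear_combination x ^ 2 * hκ2
  have h2 : 0 < positiveRoot m + 2 * m := by
    by_contra h
    have : positiveRoot m * (positiveRoot m + 2 * m) ≤ 0 :=
      mul_nonpos_of_nonneg_of_nonpos hκ.le (not_lt.1 h)
    nlinarith
  have h3 : 0 < ρ + x * (positiveRoot m + 2 * m) := by positivity
  rw [hfac, mul_pos_iff_of_pos_right h3, sub_pos]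

/-- After squaring, `1 - r ^ 2 = q ^ 2` makes the difference of the two sides `q ^ 2` times the
quadratic of `mul_positiveRoot_lt_iff`. -/
theorem lt_norm_add_polar_iff {r q x ρ θ : ℝ} (hq : 0 < q) (hrq : r ^ 2 + q ^ 2 = 1) (hx : 0 ≤ x)
    (hρ : 0 < ρ) :
    x < ‖(r * x + q * (ρ * (Real.cos θ + Real.sin θ * Complex.I)) : ℂ)‖
      ↔ x * positiveRoot (r / q * Real.cos θ) < ρ := by
  rw [mul_positiveRoot_lt_iff hx hρ, ← pow_lt_pow_iff_left₀ hx (norm_nonneg _) two_ne_zero,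
    ← Complex.normSq_eq_norm_sq, Complex.normSq_apply, ← sub_pos,
    ← mul_pos_iff_of_pos_left (b := ρ ^ 2 + _ * x * ρ - x ^ 2) (show 0 < q ^ 2 by positivity)]
  simp only [Complex.add_re, Complex.mul_re, Complex.ofReal_re, Complex.ofReal_im, Complex.I_re,
    Complex.I_im, Complex.add_im, Complex.mul_im]
  have h : q ^ 2 * (ρ ^ 2 + 2 * (r / q * Real.cos θ) * x * ρ - x ^ 2)
      = q ^ 2 * ρ ^ 2 + 2 * q * r * Real.cos θ * x * ρ - q ^ 2 * x ^ 2 := by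
    field_simp
  rw [h]
  have h2 := Real.sin_sq_add_cos_sq θ
  refine iff_of_eq (congrArg _ ?_)
  linear_combination x ^ 2 * hrq + q ^ 2 * ρ ^ 2 * h2

/-- The Gaussian measure of the exterior of a disc that contains the origin, in polar
coordinates. -/
theorem complexGaussian_lt_norm_add {r q x : ℝ} (hq : 0 < q) (hrq : r ^ 2 + q ^ 2 = 1)
    (hx : 0 ≤ x) :
    complexGaussian {w : ℂ | x < ‖r * x + q * w‖}
      = ∫⁻ θ in Set.Ioo (-Real.pi) Real.pi, ENNReal.ofReal
        ((2 * Real.pi)⁻¹ * Real.exp (-(positiveRoot (r / q * Real.cos θ) ^ 2 * x ^ 2))) := by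
  have hS : MeasurableSet {w : ℂ | x < ‖r * x + q * w‖} :=
    measurableSet_lt measurable_const (by fun_prop)
  have hind : Measurable ({w : ℂ | x < ‖r * x + q * w‖}.indicator (1 : ℂ → ENNReal)) :=
    measurable_one.indicator hS
  rw [← lintegral_indicator_one hS, lintegral_complexGaussian hind,
    ← Complex.lintegral_comp_polarCoord_symm, polarCoord_target,
    Measure.volume_eq_prod, ← Measure.prod_restrict, lintegral_prod_symm]
  swap
  · have hsymm : Measurable (fun p : ℝ × ℝ => Complex.polarCoord.symm p) := by
      simp_rw [Complex.polarCoord_symm_apply]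
      fun_prop
    have : Measurable fun z : ℂ => ENNReal.ofReal (Real.pi⁻¹ * Real.exp (-‖z‖ ^ 2)) := by fun_prop
    exact ((by fun_prop : Measurable fun p : ℝ × ℝ => ENNReal.ofReal p.1).mul
      ((this.mul hind).comp hsymm)).aemeasurable
  refine lintegral_congr fun θ => ?_
  -- The radius at which the ray of angle `θ` leaves the disc.
  set d := x * positiveRoot (r / q * Real.cos θ) with hd
  have hd0 : 0 ≤ d := mul_nonneg hx (positiveRoot_pos _).le
  have hπ := Real.pi_pos
  have hcongr : ∀ ρ ∈ Set.Ioi (0 : ℝ),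
      ENNReal.ofReal ρ • (ENNReal.ofReal
          (Real.pi⁻¹ * Real.exp (-‖Complex.polarCoord.symm (ρ, θ)‖ ^ 2))
        * {w : ℂ | x < ‖r * x + q * w‖}.indicator (1 : ℂ → ENNReal)
          (Complex.polarCoord.symm (ρ, θ)))
      = (Set.Ioi d).indicator (fun ρ => ENNReal.ofReal Real.pi⁻¹
        * ENNReal.ofReal (ρ * Real.exp (-ρ ^ 2))) ρ := by
    intro ρ hρ
    have hρ0 : 0 < ρ := hρ
    have hiff : (ρ * (Real.cos θ + Real.sin θ * Complex.I) : ℂ) ∈ {w : ℂ | x < ‖r * x + q * w‖}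
        ↔ d < ρ := lt_norm_add_polar_iff hq hrq hx hρ0
    rw [Complex.norm_polarCoord_symm, Complex.polarCoord_symm_apply, sq_abs]
    dsimp only
    by_cases h : d < ρ
    · rw [Set.indicator_of_mem (show ρ ∈ Set.Ioi d from h),
        Set.indicator_of_mem (hiff.2 h)]
      simp only [Pi.one_apply, mul_one, smul_eq_mul]
      rw [← ENNReal.ofReal_mul hρ0.le, ← ENNReal.ofReal_mul (by positivity)]
      congr 1
      ring
    · rw [Set.indicator_of_notMem (show ρ ∉ Set.Ioi d from h),
        Set.indicator_of_notMem (fun h' => h (hiff.1 h'))]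
      simp
  rw [setLIntegral_congr_fun measurableSet_Ioi hcongr, lintegral_indicator measurableSet_Ioi,
    Measure.restrict_restrict measurableSet_Ioi,
    Set.inter_eq_left.2 (Set.Ioi_subset_Ioi hd0), lintegral_const_mul _ (by fun_prop),
    lintegral_Ioi_mul_exp_neg_sq hd0, ← ENNReal.ofReal_mul (by positivity), hd, mul_pow]
  congr 1
  rw [mul_comm (x ^ 2)]
  field_simp

/-- Rotating `w` by the phase of `z` preserves its law, so `z` may be replaced by `‖z‖`. -/
theorem complexGaussian_norm_lt_norm_add {r q : ℝ} (hq : 0 < q) (hrq : r ^ 2 + q ^ 2 = 1) (z : ℂ) :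
    complexGaussian {w : ℂ | ‖z‖ < ‖r * z + q * w‖}
      = ∫⁻ θ in Set.Ioo (-Real.pi) Real.pi, ENNReal.ofReal
        ((2 * Real.pi)⁻¹ * Real.exp (-(positiveRoot (r / q * Real.cos θ) ^ 2 * ‖z‖ ^ 2))) := by
  obtain ⟨c, hc, hz⟩ : ∃ c : ℂ, ‖c‖ = 1 ∧ z = c * ‖z‖ :=
    ⟨Complex.exp (z.arg * Complex.I), Complex.norm_exp_ofReal_mul_I _, by
      rw [mul_comm, Complex.norm_mul_exp_arg_mul_I]⟩
  rw [← complexGaussian_lt_norm_add hq hrq (norm_nonneg z), ← map_mul_complexGaussian hc,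
    Measure.map_apply (by fun_prop) (measurableSet_lt measurable_const (by fun_prop)),
    map_mul_complexGaussian hc]
  congr 1
  ext w
  simp only [Set.mem_ofPred_eq, Set.mem_preimage]
  have : r * z + q * (c * w) = c * (r * ‖z‖ + q * w) := by
    conv_lhs => rw [hz]
    ring
  rw [this, norm_mul, hc, one_mul]

/-! ### Averaging over the first projection -/

/-- The conditional weight `1 / (1 + κ²)` of the direction with parameter `m`. -/
noncomputable def weight (m : ℝ) : ℝ := 1 / 2 + m / (2 * √(1 + m ^ 2))

theorem inv_one_add_positiveRoot_sq (m : ℝ) : (1 + positiveRoot m ^ 2)⁻¹ = weight m := by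
  have h := Real.sq_sqrt (show 0 ≤ 1 + m ^ 2 by positivity)
  have h0 : 0 < √(1 + m ^ 2) := by positivity
  have h1 := positiveRoot_pos m
  rw [weight, inv_eq_iff_eq_inv]
  refine eq_inv_of_mul_eq_one_left ?_
  rw [positiveRoot] at *
  field_simp
  linear_combination (√(1 + m ^ 2) - m) * h

/-- Condition on the first coordinate and exchange its integral with the one over `θ`; for fixed `θ`
what remains is a Gaussian integral with `k = κ²`. -/
theorem prod_complexGaussian_norm_lt {r q : ℝ} (hq : 0 < q) (hrq : r ^ 2 + q ^ 2 = 1) (s : ℝ) :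
    (complexGaussian.prod complexGaussian) {p : ℂ × ℂ | ‖s + p.1‖ < ‖r * (s + p.1) + q * p.2‖}
      = ∫⁻ θ in Set.Ioo (-Real.pi) Real.pi, ENNReal.ofReal
        ((2 * Real.pi)⁻¹ * (weight (r / q * Real.cos θ)
          * Real.exp (-(s ^ 2 * (1 - weight (r / q * Real.cos θ)))))) := by
  rw [Measure.prod_apply (measurableSet_lt (by fun_prop) (by fun_prop))]
  have h1 : ∀ z : ℂ, complexGaussian (Prod.mk z ⁻¹'
      {p : ℂ × ℂ | ‖s + p.1‖ < ‖r * (s + p.1) + q * p.2‖})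
      = ∫⁻ θ in Set.Ioo (-Real.pi) Real.pi, ENNReal.ofReal
        ((2 * Real.pi)⁻¹ * Real.exp (-(positiveRoot (r / q * Real.cos θ) ^ 2 * ‖s + z‖ ^ 2))) :=
    fun z => complexGaussian_norm_lt_norm_add hq hrq (s + z)
  simp_rw [h1]
  rw [lintegral_lintegral_swap (by fun_prop)]
  refine lintegral_congr fun θ => ?_
  have hπ := Real.pi_pos
  simp_rw [ENNReal.ofReal_mul (show 0 ≤ (2 * Real.pi)⁻¹ by positivity)]
  rw [lintegral_const_mul _ (by fun_prop),
    lintegral_exp_neg_mul_norm_sq_complexGaussian (sq_nonneg _), inv_one_add_positiveRoot_sq]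
  congr 4
  rw [← inv_one_add_positiveRoot_sq]
  have : 0 < 1 + positiveRoot (r / q * Real.cos θ) ^ 2 := by positivity
  field_simp
  ring

/-! ### Monotonicity for a pair of opposite directions -/

/-- The half-deviation of the weight from `1/2`. -/
noncomputable def deviation (m : ℝ) : ℝ := m / (2 * √(1 + m ^ 2))

@[fun_prop]
theorem continuous_deviation : Continuous deviation := by
  unfold deviation
  refine continuous_id.div (by fun_prop) fun m => ?_
  positivity

theorem weight_eq (m : ℝ) : weight m = 1 / 2 + deviation m := rfl

theorem weight_pos (m : ℝ) : 0 < weight m := by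
  rw [← inv_one_add_positiveRoot_sq]; positivity

theorem deviation_neg (m : ℝ) : deviation (-m) = -deviation m := by
  simp [deviation, neg_div]

theorem abs_deviation_lt_half (m : ℝ) : |deviation m| < 1 / 2 := by
  have h1 := weight_pos m
  have h2 := weight_pos (-m)
  rw [weight_eq] at h1 h2
  rw [deviation_neg] at h2
  exact abs_lt.2 ⟨by linarith, by linarith⟩

theorem deviation_sq (m : ℝ) : deviation m ^ 2 = (1 - (1 + m ^ 2)⁻¹) / 4 := by
  rw [deviation, div_pow, mul_pow, Real.sq_sqrt (by positivity)]
  field_simp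
  ring

/-- The square of the deviation is a strictly increasing function of `m ^ 2`. -/
theorem abs_deviation_lt_iff {a b : ℝ} : |deviation a| < |deviation b| ↔ |a| < |b| := by
  rw [← sq_lt_sq, ← sq_lt_sq, deviation_sq, deviation_sq]
  rw [div_lt_div_iff_of_pos_right (by norm_num), sub_lt_sub_iff_left,
    inv_lt_inv₀ (by positivity) (by positivity), add_lt_add_iff_left]

theorem abs_deviation_le_iff {a b : ℝ} : |deviation a| ≤ |deviation b| ↔ |a| ≤ |b| := by
  rw [← not_lt, abs_deviation_lt_iff, not_lt]

/-- The contribution of a pair of opposite directions to the pairwise error probability. -/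
noncomputable def pairTerm (S x : ℝ) : ℝ :=
  (1 / 2 + x) * Real.exp (-(S * (1 / 2 - x))) + (1 / 2 - x) * Real.exp (-(S * (1 / 2 + x)))

/-- In this form, growth in `x ≥ 0` is visible summand by summand. -/
theorem pairTerm_eq_cosh_add (S x : ℝ) :
    pairTerm S x = Real.exp (-(S / 2)) * (Real.cosh (S * x) + 2 * (x * Real.sinh (S * x))) := by
  have h1 : -(S * (1 / 2 - x)) = -(S / 2) + S * x := by ring
  have h2 : -(S * (1 / 2 + x)) = -(S / 2) + -(S * x) := by ring
  rw [pairTerm, h1, h2, Real.exp_add, Real.exp_add, Real.cosh_eq, Real.sinh_eq]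
  ring

theorem pairTerm_abs (S x : ℝ) : pairTerm S |x| = pairTerm S x := by
  rcases abs_choice x with h | h <;> rw [h]
  simp only [pairTerm]
  ring_nf

theorem strictMonoOn_pairTerm {S : ℝ} (hS : 0 < S) : StrictMonoOn (pairTerm S) (Set.Ici 0) := by
  intro x hx y _ hxy
  have hx : 0 ≤ x := hx
  have hy : 0 ≤ y := hx.trans hxy.le
  have hS' : S * x < S * y := mul_lt_mul_of_pos_left hxy hS
  rw [pairTerm_eq_cosh_add, pairTerm_eq_cosh_add]
  refine mul_lt_mul_of_pos_left (add_lt_add_of_lt_of_le ?_ ?_) (Real.exp_pos _)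
  · rw [Real.cosh_lt_cosh, abs_of_nonneg (by positivity), abs_of_nonneg (by positivity)]
    exact hS'
  · have : 0 ≤ Real.sinh (S * x) := Real.sinh_nonneg_iff.2 (by positivity)
    have : Real.sinh (S * x) ≤ Real.sinh (S * y) := Real.sinh_le_sinh.2 hS'.le
    gcongr

theorem pairTerm_lt_of_abs_lt {S x y : ℝ} (hS : 0 < S) (h : |x| < |y|) :
    pairTerm S x < pairTerm S y := by
  rw [← pairTerm_abs S x, ← pairTerm_abs S y]
  exact strictMonoOn_pairTerm hS (abs_nonneg x) (abs_nonneg y) h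

theorem pairTerm_le_of_abs_le {S x y : ℝ} (hS : 0 < S) (h : |x| ≤ |y|) :
    pairTerm S x ≤ pairTerm S y := by
  rw [← pairTerm_abs S x, ← pairTerm_abs S y]
  exact (strictMonoOn_pairTerm hS).monotoneOn (abs_nonneg x) (abs_nonneg y) h

/-- Both `1/2 + x` and `1/2 - x` are positive, so each exponential has a positive coefficient and a
positive decay rate in `S`. -/
theorem strictAnti_pairTerm {x : ℝ} (hx : |x| < 1 / 2) : StrictAnti fun S => pairTerm S x := by
  intro S T hST
  obtain ⟨h1, h2⟩ := abs_lt.1 hx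
  have h3 : 0 < 1 / 2 + x := by linarith
  have h4 : 0 < 1 / 2 - x := by linarith
  simp only [pairTerm]
  gcongr

/-! ### The error probability as an integral, and its monotonicity -/

/-- The pairwise error probability as a function of the normalised metric `r` and of
`S = ρ M β`. -/
noncomputable def errorProb (r S : ℝ) : ℝ :=
  ∫ θ in -Real.pi..Real.pi, (2 * Real.pi)⁻¹ * (weight (r / √(1 - r ^ 2) * Real.cos θ)
    * Real.exp (-(S * (1 - weight (r / √(1 - r ^ 2) * Real.cos θ)))))

theorem continuous_pairTerm (S t : ℝ) :
    Continuous fun θ => pairTerm S (deviation (t * Real.cos θ)) := by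
  unfold pairTerm
  fun_prop

/-- A shift by `π` preserves the integral over a period and changes the sign of the cosine.
Averaging the integral with its shift explains `4π` in place of `2π`. -/
theorem errorProb_eq_integral_pairTerm (r S : ℝ) :
    errorProb r S = (4 * Real.pi)⁻¹ * ∫ θ in -Real.pi..Real.pi,
      pairTerm S (deviation (r / √(1 - r ^ 2) * Real.cos θ)) := by
  rw [errorProb, intervalIntegral.integral_const_mul]
  set t := r / √(1 - r ^ 2)
  set h : ℝ → ℝ := fun θ => weight (t * Real.cos θ)
    * Real.exp (-(S * (1 - weight (t * Real.cos θ)))) with hh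
  have hcont : Continuous h := by
    simp only [hh, weight_eq]
    fun_prop
  have hper : Function.Periodic h (2 * Real.pi) := by
    intro θ
    simp only [hh, Real.cos_add_two_pi]
  have hshift : ∫ θ in -Real.pi..Real.pi, h (θ + Real.pi) = ∫ θ in -Real.pi..Real.pi, h θ := by
    rw [intervalIntegral.integral_comp_add_right]
    have := hper.intervalIntegral_add_eq 0 (-Real.pi)
    rw [show -Real.pi + 2 * Real.pi = Real.pi by ring, zero_add] at this
    rw [← this]
    congr 1 <;> ring
  have hpair : ∫ θ in -Real.pi..Real.pi, pairTerm S (deviation (t * Real.cos θ))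
      = (∫ θ in -Real.pi..Real.pi, h θ) + ∫ θ in -Real.pi..Real.pi, h (θ + Real.pi) := by
    rw [← intervalIntegral.integral_add (hcont.intervalIntegrable _ _)
      ((show Continuous fun θ => h (θ + Real.pi) from
        hcont.comp (continuous_add_const _)).intervalIntegrable _ _)]
    refine intervalIntegral.integral_congr fun θ _ => ?_
    simp only [hh, pairTerm, weight_eq, Real.cos_add_pi, mul_neg, deviation_neg]
    ring_nf
  rw [hpair, hshift]
  have := Real.pi_ne_zero
  field_simp
  ring

theorem div_sqrt_one_sub_sq_lt {a b : ℝ} (ha : 0 ≤ a) (hab : a < b) (hb : b < 1) :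
    a / √(1 - a ^ 2) < b / √(1 - b ^ 2) := by
  have h1 : 0 < 1 - b ^ 2 := by nlinarith
  have h2 : 1 - b ^ 2 ≤ 1 - a ^ 2 := by nlinarith
  have h3 : 0 < √(1 - b ^ 2) := Real.sqrt_pos.2 h1
  exact div_lt_div₀ hab (Real.sqrt_le_sqrt h2) (ha.trans hab.le) h3

theorem errorProb_lt_errorProb {r₁ r₂ S₁ S₂ : ℝ} (hr : 0 ≤ r₁) (h : r₁ ≤ r₂) (hr2 : r₂ < 1)
    (hS : 0 < S₂) (hS12 : S₂ ≤ S₁) (hlt : r₁ < r₂ ∨ S₂ < S₁) :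
    errorProb r₁ S₁ < errorProb r₂ S₂ := by
  rw [errorProb_eq_integral_pairTerm, errorProb_eq_integral_pairTerm]
  set t₁ := r₁ / √(1 - r₁ ^ 2)
  set t₂ := r₂ / √(1 - r₂ ^ 2)
  have ht₁ : 0 ≤ t₁ := by positivity
  have ht : t₁ ≤ t₂ := by
    rcases h.eq_or_lt with h | h
    · exact (congrArg (fun r : ℝ => r / √(1 - r ^ 2)) h).le
    · exact (div_sqrt_one_sub_sq_lt hr h hr2).le
  have hdev : ∀ c, |deviation (t₁ * c)| ≤ |deviation (t₂ * c)| := by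
    intro c
    rw [abs_deviation_le_iff, abs_mul, abs_mul, abs_of_nonneg ht₁, abs_of_nonneg (ht₁.trans ht)]
    gcongr
  have hπ := Real.pi_pos
  refine mul_lt_mul_of_pos_left ?_ (by positivity)
  refine intervalIntegral.integral_lt_integral_of_continuousOn_of_le_of_exists_lt (by linarith)
    (continuous_pairTerm _ _).continuousOn (continuous_pairTerm _ _).continuousOn
    -- Strictness is tested at `θ = 0`, where `cos θ = 1`, so that `r₁ < r₂` gives a strict gap; at
    -- `cos θ = 0` there would be none.
    (fun θ _ => ?_) ⟨0, ⟨by linarith, hπ.le⟩, ?_⟩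
  · exact ((strictAnti_pairTerm (abs_deviation_lt_half _)).antitone hS12).trans
      (pairTerm_le_of_abs_le hS (hdev _))
  · rcases hlt with hlt | hlt
    · refine ((strictAnti_pairTerm (abs_deviation_lt_half _)).antitone hS12).trans_lt
        (pairTerm_lt_of_abs_lt hS ?_)
      rw [abs_deviation_lt_iff, Real.cos_zero, mul_one, mul_one, abs_of_nonneg ht₁,
        abs_of_nonneg (ht₁.trans ht)]
      exact div_sqrt_one_sub_sq_lt hr hlt hr2
    · exact (strictAnti_pairTerm (abs_deviation_lt_half _) hlt).trans_le
        (pairTerm_le_of_abs_le hS (hdev _))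

/-! ### From the noise matrix to two Gaussian variables -/

theorem prod_complexGaussian_real_eq_errorProb {r : ℝ} (hr : r ^ 2 < 1) (s : ℝ) :
    (complexGaussian.prod complexGaussian).real
      {p : ℂ × ℂ | ‖s + p.1‖ < ‖r * (s + p.1) + (√(1 - r ^ 2) : ℝ) * p.2‖}
      = errorProb r (s ^ 2) := by
  have h1 : 0 < 1 - r ^ 2 := by linarith
  rw [measureReal_def, prod_complexGaussian_norm_lt (Real.sqrt_pos.2 h1)
    (by rw [Real.sq_sqrt h1.le]; ring), errorProb,
    intervalIntegral.integral_of_le (by linarith [Real.pi_pos]), integral_Ioc_eq_integral_Ioo,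
    integral_eq_lintegral_of_nonneg_ae]
  · refine Filter.Eventually.of_forall fun θ => ?_
    have := weight_pos (r / √(1 - r ^ 2) * Real.cos θ)
    have := Real.pi_pos
    positivity
  · simp only [weight_eq]
    fun_prop

/-- The error probability of two unit-norm signals with real correlation `r`. -/
theorem noiseLaw_real_eq_errorProb {M τ : ℕ} {u v : Fin M → Fin τ → ℂ} {r : ℝ}
    (hu : ∑ i, ∑ j, ‖u i j‖ ^ 2 = 1) (hv : ∑ i, ∑ j, ‖v i j‖ ^ 2 = 1)
    (huv : ∑ i, ∑ j, conj (v i j) * u i j = r) (hr : r ^ 2 < 1) (s : ℝ) :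
    (noiseLaw M τ).real {W | ‖∑ i, ∑ j, conj (u i j) * (s * u i j + W i j)‖
      < ‖∑ i, ∑ j, conj (v i j) * (s * u i j + W i j)‖} = errorProb r (s ^ 2) := by
  have h1 : 0 < 1 - r ^ 2 := by linarith
  set q := √(1 - r ^ 2) with hq
  have hq0 : 0 < q := Real.sqrt_pos.2 h1
  have hq2 : q ^ 2 = 1 - r ^ 2 := Real.sq_sqrt h1.le
  have hqC : (q : ℂ) ≠ 0 := Complex.ofReal_ne_zero.2 hq0.ne'
  have huu : ∑ i, ∑ j, conj (u i j) * u i j = 1 := by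
    simp_rw [Complex.conj_mul', ← Complex.ofReal_pow, ← Complex.ofReal_sum]
    rw [hu, Complex.ofReal_one]
  -- Gram–Schmidt: the normalised component of `v` orthogonal to `u`.
  set w : Fin M → Fin τ → ℂ := fun i j => (v i j - r * u i j) / q with hw
  have hvw : ∀ i j, v i j = r * u i j + q * w i j := by
    intro i j
    simp only [hw]
    field_simp
    ring
  have hwu : ∑ i, ∑ j, conj (w i j) * u i j = 0 := by
    have : ∀ i j, conj (w i j) * u i j
        = (q : ℂ)⁻¹ * (conj (v i j) * u i j) - (q : ℂ)⁻¹ * r * (conj (u i j) * u i j) := by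
      intro i j
      simp only [hw, map_div₀, map_sub, map_mul, Complex.conj_ofReal]
      ring
    simp_rw [this, Finset.sum_sub_distrib, ← Finset.mul_sum]
    rw [huv, huu]
    ring
  have hww : ∑ i, ∑ j, ‖w i j‖ ^ 2 = 1 := by
    have : ∀ i j, ‖w i j‖ ^ 2
        = (‖v i j‖ ^ 2 + r ^ 2 * ‖u i j‖ ^ 2 - 2 * r * (conj (v i j) * u i j).re) / q ^ 2 := by
      intro i j
      simp only [hw, norm_div, div_pow, Complex.norm_real, Real.norm_eq_abs, sq_abs]
      congr 1
      simp only [← Complex.normSq_eq_norm_sq, Complex.normSq_apply, Complex.sub_re, Complex.sub_im,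
        Complex.mul_re, Complex.mul_im, Complex.ofReal_re, Complex.ofReal_im, Complex.conj_re,
        Complex.conj_im]
      ring
    simp_rw [this, ← Finset.sum_div, Finset.sum_sub_distrib, Finset.sum_add_distrib,
      ← Finset.mul_sum, ← Complex.re_sum]
    rw [hu, hv, huv, Complex.ofReal_re, hq2]
    field_simp
    ring
  have hset : {W : Fin M → Fin τ → ℂ | ‖∑ i, ∑ j, conj (u i j) * (s * u i j + W i j)‖
      < ‖∑ i, ∑ j, conj (v i j) * (s * u i j + W i j)‖}
      = (fun W => (∑ i, ∑ j, conj (u i j) * W i j, ∑ i, ∑ j, conj (w i j) * W i j)) ⁻¹'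
        {p : ℂ × ℂ | ‖s + p.1‖ < ‖r * (s + p.1) + q * p.2‖} := by
    ext W
    have hU : ∑ i, ∑ j, conj (u i j) * (s * u i j + W i j)
        = s + ∑ i, ∑ j, conj (u i j) * W i j := by
      have : ∀ i j, conj (u i j) * (s * u i j + W i j)
          = s * (conj (u i j) * u i j) + conj (u i j) * W i j := fun i j => by ring
      simp_rw [this, Finset.sum_add_distrib, ← Finset.mul_sum]
      rw [huu, mul_one]
    have hV : ∑ i, ∑ j, conj (v i j) * (s * u i j + W i j)
        = r * (s + ∑ i, ∑ j, conj (u i j) * W i j) + q * ∑ i, ∑ j, conj (w i j) * W i j := by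
      have : ∀ i j, conj (v i j) * (s * u i j + W i j) = s * (conj (v i j) * u i j)
          + (r * (conj (u i j) * W i j) + q * (conj (w i j) * W i j)) := by
        intro i j
        have : conj (v i j) = r * conj (u i j) + q * conj (w i j) := by
          rw [hvw, map_add, map_mul, map_mul, Complex.conj_ofReal, Complex.conj_ofReal]
        linear_combination W i j * this
      simp_rw [this, Finset.sum_add_distrib, ← Finset.mul_sum]
      rw [huv]
      ring
    simp only [Set.mem_ofPred_eq, Set.mem_preimage]
    rw [hU, hV]
  rw [hset, ← map_measureReal_apply (by fun_prop) (measurableSet_lt (by fun_prop) (by fun_prop)),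
    map_noiseLaw_orthonormal hu hww hwu, prod_complexGaussian_real_eq_errorProb hr]

/-! ### From the system to two unit signals -/

namespace System

variable {M τ N : ℕ}

/-- The rank-one matrix `g_n φ_nᵀ`. -/
def signal (S : System M τ N) (n : Fin N) (i : Fin M) (j : Fin τ) : ℂ := S.beam n i * S.seq n j

theorem sum_norm_sq_signal (S : System M τ N) (n : Fin N) :
    ∑ i, ∑ j, ‖S.signal n i j‖ ^ 2 = M * S.β := by
  simp_rw [signal, norm_mul, mul_pow, ← Finset.mul_sum]
  rw [← Finset.sum_mul, S.norm_beam]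
  have : ∑ j, ‖S.seq n j‖ ^ 2 = 1 := S.norm_seq n
  rw [this, mul_one]

theorem corr_eq (S : System M τ N) (n n' : Fin N) :
    S.corr n n' = ‖∑ i, ∑ j, conj (S.signal n' i j) * S.signal n i j‖ := by
  rw [corr, ← Complex.norm_conj]
  congr 1
  simp only [dotProduct, map_mul, map_sum, signal, Pi.star_apply, RCLike.star_def,
    Complex.conj_conj]
  rw [Finset.sum_mul_sum, Finset.sum_comm]
  refine Finset.sum_congr rfl fun i _ => Finset.sum_congr rfl fun j _ => ?_
  ring

theorem statistic_eq (S : System M τ N) (Y : Matrix (Fin M) (Fin τ) ℂ) (k : Fin N) :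
    S.statistic Y k = ‖∑ i, ∑ j, conj (S.signal k i j) * Y i j‖ := by
  rw [statistic, ← Complex.norm_conj]
  congr 1
  simp only [dotProduct, Matrix.mulVec, map_mul, map_sum, signal, Matrix.conjTranspose_apply,
    RCLike.star_def, Complex.conj_conj, Finset.mul_sum]
  rw [Finset.sum_comm]
  refine Finset.sum_congr rfl fun i _ => Finset.sum_congr rfl fun j _ => ?_
  ring

theorem corr_nonneg (S : System M τ N) (n n' : Fin N) : 0 ≤ S.corr n n' := norm_nonneg _

/-- The pairwise error probability depends only on `c / (M β)` and `√(ρ M β)`. -/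
theorem pep_eq_errorProb (S : System M τ N) (n n' : Fin N) (h : S.corr n n' < M * S.β) :
    S.pep n n' = errorProb (S.corr n n' / (M * S.β)) (√(S.ρ * M * S.β) ^ 2) := by
  have hA : 0 < M * S.β := (S.corr_nonneg n n').trans_lt h
  set A := M * S.β with hAdef
  set a := √A with ha
  have ha0 : 0 < a := Real.sqrt_pos.2 hA
  have ha2 : a ^ 2 = A := Real.sq_sqrt hA.le
  have haC : (a : ℂ) ≠ 0 := Complex.ofReal_ne_zero.2 ha0.ne'
  have haC2 : (a : ℂ) ^ 2 = A := by rw [← Complex.ofReal_pow, ha2]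
  set e := Complex.exp (Complex.I * S.θ) with he
  have he1 : ‖e‖ = 1 := by rw [he, mul_comm, Complex.norm_exp_ofReal_mul_I]
  set X := ∑ i, ∑ j, conj (S.signal n' i j) * S.signal n i j with hX
  -- The phase of `e * X`. Multiplying the competing signal by it leaves its statistic unchanged and
  -- makes the correlation real and nonnegative; `e` in `u` absorbs the unknown phase shift.
  obtain ⟨c, hc, hcX⟩ : ∃ c : ℂ, ‖c‖ = 1 ∧ conj c * (e * X) = ‖X‖ := by
    refine ⟨Complex.exp ((e * X).arg * Complex.I), Complex.norm_exp_ofReal_mul_I _, ?_⟩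
    have h1 := Complex.norm_mul_exp_arg_mul_I (e * X)
    have h2 : ‖e * X‖ = ‖X‖ := by rw [norm_mul, he1, one_mul]
    have h3 : conj (Complex.exp ((e * X).arg * Complex.I)) * Complex.exp ((e * X).arg * Complex.I)
        = 1 := by
      rw [Complex.conj_mul', Complex.norm_exp_ofReal_mul_I]; simp
    rw [h2] at h1
    linear_combination (‖X‖ : ℂ) * h3 - conj (Complex.exp ((e * X).arg * Complex.I)) * h1
  set u : Fin M → Fin τ → ℂ := fun i j => e * S.signal n i j / a with hu
  set v : Fin M → Fin τ → ℂ := fun i j => c * S.signal n' i j / a with hv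
  have hnorm : ∀ (b : ℂ) (k : Fin N), ‖b‖ = 1 → ∑ i, ∑ j, ‖b * S.signal k i j / a‖ ^ 2 = 1 := by
    intro b k hb
    simp_rw [norm_div, norm_mul, hb, one_mul, div_pow, Complex.norm_real, Real.norm_eq_abs, sq_abs,
      ← Finset.sum_div]
    rw [sum_norm_sq_signal, ← hAdef, ha2, div_self hA.ne']
  have huv : ∑ i, ∑ j, conj (v i j) * u i j = ((S.corr n n' / A : ℝ) : ℂ) := by
    have : ∀ i j, conj (v i j) * u i j
        = conj c * e / a ^ 2 * (conj (S.signal n' i j) * S.signal n i j) := by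
      intro i j
      simp only [hu, hv, map_div₀, map_mul, Complex.conj_ofReal]
      ring
    simp_rw [this, ← Finset.mul_sum]
    rw [← hX, haC2, corr_eq, ← hX, Complex.ofReal_div, ← hcX]
    ring
  have hr0 : 0 ≤ S.corr n n' / A := div_nonneg (S.corr_nonneg n n') hA.le
  have hr1 : S.corr n n' / A < 1 := (div_lt_one hA).2 h
  have hs : (√(S.ρ * M * S.β) : ℂ) = √S.ρ * a := by
    rw [mul_assoc, ← hAdef, Real.sqrt_mul S.ρ_pos.le, Complex.ofReal_mul]
  have hY : ∀ W i j, S.received n W i j = √(S.ρ * M * S.β) * u i j + W i j := by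
    intro W i j
    simp only [received, Matrix.add_apply, Matrix.smul_apply, Matrix.vecMulVec_apply,
      Matrix.of_apply, smul_eq_mul, hs, hu, signal, ← he]
    field_simp
  -- A unit factor `b` does not affect the modulus, so one identity serves the true signal (`b = e`)
  -- and the competitor (`b = c`).
  have hstat : ∀ (b : ℂ) (k : Fin N) (W : Fin M → Fin τ → ℂ), ‖b‖ = 1 →
      S.statistic (S.received n W) k = a * ‖∑ i, ∑ j, conj (b * S.signal k i j / a)
        * (√(S.ρ * M * S.β) * u i j + W i j)‖ := by
    intro b k W hb
    rw [statistic_eq]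
    have : ∀ i j, conj (b * S.signal k i j / a) * (√(S.ρ * M * S.β) * u i j + W i j)
        = conj b / a * (conj (S.signal k i j) * S.received n W i j) := by
      intro i j
      rw [hY, map_div₀, map_mul, Complex.conj_ofReal]
      ring
    simp_rw [this, ← Finset.mul_sum]
    rw [norm_mul, norm_div, Complex.norm_conj, hb, Complex.norm_real, Real.norm_eq_abs,
      abs_of_pos ha0]
    field_simp
  rw [pep, ← noiseLaw_real_eq_errorProb (hnorm e n he1) (hnorm c n' hc) huv (by nlinarith)]
  congr 1
  ext W
  simp only [Set.mem_ofPred_eq]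
  rw [hstat e n W he1, hstat c n' W hc, mul_lt_mul_iff_right₀ ha0]

end System

end PartialCSI

/-! ### Comparison of two systems -/

theorem proposition2 {M₁ τ₁ N₁ M₂ τ₂ N₂ : ℕ}
    (S₁ : PartialCSI.System M₁ τ₁ N₁) (S₂ : PartialCSI.System M₂ τ₂ N₂)
    (n₁ n₁' : Fin N₁) (n₂ n₂' : Fin N₂)
    (h₁ : S₁.corr n₁ n₁' < M₁ * S₁.β) (h₂ : S₂.corr n₂ n₂' < M₂ * S₂.β) :
    -- a smaller metric, at the same SNR and the same beam norm
    (S₁.ρ = S₂.ρ → M₁ * S₁.β = M₂ * S₂.β → S₁.corr n₁ n₁' < S₂.corr n₂ n₂' →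
      S₁.pep n₁ n₁' < S₂.pep n₂ n₂') ∧
    -- a larger `√(ρMβ)`, by a larger SNR, larger beam norms, or both, at the same metric
    (S₁.corr n₁ n₁' = S₂.corr n₂ n₂' → S₂.ρ ≤ S₁.ρ → M₂ * S₂.β ≤ M₁ * S₁.β →
      Real.sqrt (S₂.ρ * M₂ * S₂.β) < Real.sqrt (S₁.ρ * M₁ * S₁.β) →
      S₁.pep n₁ n₁' < S₂.pep n₂ n₂') ∧
    -- the two monotonicities jointly, in terms of the normalised metric and `√(ρMβ)`
    (S₁.corr n₁ n₁' / (M₁ * S₁.β) ≤ S₂.corr n₂ n₂' / (M₂ * S₂.β) →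
      Real.sqrt (S₂.ρ * M₂ * S₂.β) ≤ Real.sqrt (S₁.ρ * M₁ * S₁.β) →
      S₁.pep n₁ n₁' ≤ S₂.pep n₂ n₂' ∧
      (S₁.corr n₁ n₁' / (M₁ * S₁.β) < S₂.corr n₂ n₂' / (M₂ * S₂.β) ∨
        Real.sqrt (S₂.ρ * M₂ * S₂.β) < Real.sqrt (S₁.ρ * M₁ * S₁.β) →
        S₁.pep n₁ n₁' < S₂.pep n₂ n₂')) := by
  have hA₁ : 0 < M₁ * S₁.β := (S₁.corr_nonneg n₁ n₁').trans_lt h₁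
  have hA₂ : 0 < M₂ * S₂.β := (S₂.corr_nonneg n₂ n₂').trans_lt h₂
  have hs₂ : 0 < Real.sqrt (S₂.ρ * M₂ * S₂.β) := by
    rw [mul_assoc]
    exact Real.sqrt_pos.2 (mul_pos S₂.ρ_pos hA₂)
  have hlt : S₁.corr n₁ n₁' / (M₁ * S₁.β) ≤ S₂.corr n₂ n₂' / (M₂ * S₂.β) →
      Real.sqrt (S₂.ρ * M₂ * S₂.β) ≤ Real.sqrt (S₁.ρ * M₁ * S₁.β) →
      (S₁.corr n₁ n₁' / (M₁ * S₁.β) < S₂.corr n₂ n₂' / (M₂ * S₂.β) ∨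
        Real.sqrt (S₂.ρ * M₂ * S₂.β) < Real.sqrt (S₁.ρ * M₁ * S₁.β)) →
      S₁.pep n₁ n₁' < S₂.pep n₂ n₂' := by
    intro hr hs hstrict
    rw [S₁.pep_eq_errorProb n₁ n₁' h₁, S₂.pep_eq_errorProb n₂ n₂' h₂]
    refine PartialCSI.errorProb_lt_errorProb (div_nonneg (S₁.corr_nonneg n₁ n₁') hA₁.le) hr
      ((div_lt_one hA₂).2 h₂) (pow_pos hs₂ 2) (pow_le_pow_left₀ hs₂.le hs 2)
      (hstrict.imp id fun h => pow_lt_pow_left₀ h hs₂.le two_ne_zero)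
  refine ⟨fun hρ hA hc => ?_, fun hc _ hA hs => ?_, fun hr hs => ⟨?_, hlt hr hs⟩⟩
  · have hr : S₁.corr n₁ n₁' / (M₁ * S₁.β) < S₂.corr n₂ n₂' / (M₂ * S₂.β) := by
      rw [hA]
      exact div_lt_div_of_pos_right hc hA₂
    exact hlt hr.le (by rw [mul_assoc, mul_assoc, hρ, hA]) (.inl hr)
  -- At equal `c`, a larger `M β` can only lower the normalised metric; strictness comes from `√(ρ M
  -- β)`.
  · refine hlt ?_ hs.le (.inr hs)
    rw [hc]
    exact div_le_div_of_nonneg_left (S₂.corr_nonneg n₂ n₂') hA₂ hA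
  · rcases hr.eq_or_lt with hr' | hr'
    · rcases hs.eq_or_lt with hs' | hs'
      · rw [S₁.pep_eq_errorProb n₁ n₁' h₁, S₂.pep_eq_errorProb n₂ n₂' h₂, hr', hs']
      · exact (hlt hr hs (.inr hs')).le
    · exact (hlt hr hs (.inl hr')).le
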